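/- Let $q\in\mathbb C^*$ not be a root of unity, let $s\in\{0,\tfrac12,1,\tfrac32,\dots\}$, $M\in\{0,1,\dots,2s\}$, $\mu,\mu'\in\mathbb C$ and $v\in\mathbb C^*$. Write $b(x)=x-x^{-1}$, $(x;p)_n=\prod_{k=0}^{n-1}(1-xp^k)$ and $$F(u)=q^{-(2s+1)}\big(q^{2s+1}uv^{-1}-u^{-1}v\big)\big(q^{2s+1}uv-u^{-1}v^{-1}\big)\big(u+e^{\mu+\mu'}u^{-1}\big)\big(u+e^{\mu'-\mu}u^{-1}\big).$$ Let $u_1,\dots,u_M\in\mathbb C^*$ be an admissible solution of the Bethe equations of the special case $\kappa=\kappa_\pm=0$: the symmetrized Bethe roots $U_i=\dfrac{qu_i^2+q^{-1}u_i^{-2}}{q+q^{-1}}$ are pairwise distinct, and for $i=1,\dots,M$ the Laurent polynomial $$p_i(w)=\frac{1}{b(qw^2)}\Big(F(q^{-1}w^{-1})\prod_{j\ne i}b(qw/u_j)\,b(q^2wu_j)-F(w)\prod_{j\neq i}b(w/(qu_j))\,b(wu_j)\Big)$$ (whose singularities at $qw^2=\pm1$ are removable) vanishes at $w=u_i$.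 When $qu_i^2\ne\pm1$ and no denominator below vanishes, the $i$-th of these equations is the Bethe equation $$\prod_{j\neq i}\frac{b(u_i/(qu_j))\,b(u_iu_j)}{b(qu_i/u_j)\,b(q^2u_iu_j)}=\frac{F(q^{-1}u_i^{-1})}{F(u_i)}.$$ Let $Q_M(U)=\prod_{j=1}^M(U-U_j)$ be the Q-polynomial, and put $$\mathfrak a=-qe^{-\mu+\mu'},\quad \mathfrak b=-qe^{\mu+\mu'},\quad \mathfrak c=q^{-2s}v^2,\quad \mathfrak d=q^{-2s}v^{-2}.$$ Assume that the parameters are generic in the sense that $(\mathfrak a\mathfrak b;q^2)_M$, $(\mathfrak a\mathfrak c;q^2)_M$, $(\mathfrak a\mathfrak d;q^2)_M$, $(\mathfrak a\mathfrak b\mathfrak c\mathfrak dq^{-2};q^4)_M$ and $(\mathfrak a\mathfrak b\mathfrak c\mathfrak d;q^4)_M$ are nonzero. Then for every $z\in\mathbb C^*$, with $Z=\dfrac{z+z^{-1}}{q+q^{-1}}$, $$Q_M(Z)=\frac{(\mathfrak a\mathfrak b;q^2)_M(\mathfrak a\mathfrak c;q^2)_M(\mathfrak a\mathfrak d;q^2)_M(\mathfrak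 a\mathfrak b\mathfrak c\mathfrak dq^{-2};q^2)_M}{(q+q^{-1})^M\,\mathfrak a^M(\mathfrak a\mathfrak b\mathfrak c\mathfrak dq^{-2};q^4)_M(\mathfrak a\mathfrak b\mathfrak c\mathfrak d;q^4)_M}\;P_M(z+z^{-1};\mathfrak a,\mathfrak b,\mathfrak c,\mathfrak d),$$ where $P_M$ is the Askey–Wilson polynomial in base $q^2$, $$P_M(z+z^{-1};\mathfrak a,\mathfrak b,\mathfrak c,\mathfrak d)=\sum_{k=0}^M\frac{(q^{-2M};q^2)_k(\mathfrak a\mathfrak b\mathfrak c\mathfrak dq^{2M-2};q^2)_k(\mathfrak az;q^2)_k(\mathfrak az^{-1};q^2)_k}{(\mathfrak a\mathfrak b;q^2)_k(\mathfrak a\mathfrak c;q^2)_k(\mathfrak a\mathfrak d;q^2)_k(q^2;q^2)_k}\,q^{2k}.$$ -/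

import Mathlib

open Polynomial Filter Topology

noncomputable section

namespace HeunAW

/-- The `q`-shifted factorial `(a; q)_n = ∏_{k<n} (1 - a q^k)`. -/
def qPoch (a q : ℂ) (n : ℕ) : ℂ := ∏ k ∈ Finset.range n, (1 - a * q ^ k)

/-- The Askey-Wilson polynomial `P_M(x; a, b, c, d)` in base `q²`, as a function of `z` with
`x = z + z⁻¹`: the terminating basic hypergeometric series
`₄φ₃(q^{-2M}, abcd q^{2M-2}, a z, a z⁻¹; ab, ac, ad; q², q²)`. -/
def askeyWilson (q a b c d : ℂ) (M : ℕ) (z : ℂ) : ℂ :=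
  ∑ k ∈ Finset.range (M + 1),
    qPoch (q ^ (-(2 * M : ℤ))) (q ^ 2) k * qPoch (a * b * c * d * q ^ (2 * M - 2 : ℤ)) (q ^ 2) k
        * qPoch (a * z) (q ^ 2) k * qPoch (a * z⁻¹) (q ^ 2) k
      / (qPoch (a * b) (q ^ 2) k * qPoch (a * c) (q ^ 2) k * qPoch (a * d) (q ^ 2) k
          * qPoch (q ^ 2) (q ^ 2) k)
      * (q ^ 2) ^ k

/-- `b(x) = x - x⁻¹`. -/
def bb (x : ℂ) : ℂ := x - x⁻¹

/-- The symmetrized variable `U(u) = (q u² + q⁻¹ u⁻²) / (q + q⁻¹)`. -/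
def symVar (q u : ℂ) : ℂ := (q * u ^ 2 + q⁻¹ * (u ^ 2)⁻¹) / (q + q⁻¹)

/-- The function `F₊(u)`, i.e. the eigenvalue `Λ₁⁺(u)` of the diagonal dynamical operator on the
reference state up to the factor `e^{-μ'} q^{(ν+ν')/2} / (2u)`; here `N = 2s`. Up to the same
constant and the factor `b(u²) / (u b(q u²))`, `Λ₂⁺(u)` is `F₊(q⁻¹ u⁻¹)`. -/
def vacF (q : ℂ) (N : ℕ) (μ μ' v u : ℂ) : ℂ :=
  (q ^ (N + 1))⁻¹ * (q ^ (N + 1) * u * v⁻¹ - u⁻¹ * v) * (q ^ (N + 1) * u * v - u⁻¹ * v⁻¹)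
    * (u + Complex.exp (μ + μ') * u⁻¹) * (u + Complex.exp (μ' - μ) * u⁻¹)

/-- The function whose vanishing at `w = u i` is the `i`-th Bethe equation for `κ = κ± = 0`: the
difference of the two sides of
`∏_{j≠i} b(w/(q u_j)) b(w u_j) / (b(q w/u_j) b(q² w u_j)) = F₊(q⁻¹w⁻¹) / F₊(w)`
after clearing denominators, divided by its trivial factor `b(q w²)`. It is a Laurent polynomial
in `w`: the singularities at `b(q w²) = 0` are removable. -/
def betheFun (q : ℂ) (N : ℕ) (μ μ' v : ℂ) {M : ℕ} (u : Fin M → ℂ) (i : Fin M) (w : ℂ) : ℂ :=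
  ((∏ j ∈ Finset.univ.erase i, bb (q * w / u j) * bb (q ^ 2 * w * u j))
        * vacF q N μ μ' v (q⁻¹ * w⁻¹)
      - (∏ j ∈ Finset.univ.erase i, bb (w / (q * u j)) * bb (w * u j)) * vacF q N μ μ' v w)
    / bb (q * w ^ 2)

/-- `u_1, …, u_M` is an admissible solution of the Bethe equations for `κ = κ± = 0`: the `u_i` are
nonzero, the symmetrized roots are pairwise distinct, and every Bethe equation holds. The value of
the Laurent polynomial `betheFun` at `u_i` is written as a limit, which is the plain value if
`b(q u_i²) ≠ 0` and the value at the removable singularity otherwise. -/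
structure IsBetheRoots (q : ℂ) (N : ℕ) (μ μ' v : ℂ) {M : ℕ} (u : Fin M → ℂ) : Prop where
  ne_zero : ∀ i, u i ≠ 0
  admissible : Function.Injective fun i => symVar q (u i)
  bethe : ∀ i, Tendsto (betheFun q N μ μ' v u i) (𝓝[≠] (u i)) (𝓝 0)

/-- The Q-polynomial `Q_M(U) = ∏_j (U - U_j)` with `U_j` the symmetrized Bethe roots. -/
def QPoly (q : ℂ) {M : ℕ} (u : Fin M → ℂ) : ℂ[X] := ∏ j, (X - C (symVar q (u j)))

end HeunAW

end

open Polynomial Filter Topology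

noncomputable section

namespace HeunAW

/-! Put `p = q²`, `z = q w²`, `x = z + z⁻¹`. The Bethe equations say that the Q-polynomial is an
eigenfunction of the Askey–Wilson difference operator. Pulling the factor of the `i`-th root out of
the operator leaves a multiple of the Bethe function plus a term vanishing at that root
(`awOp_betheProd_univ`), so the image of the Q-polynomial vanishes at every root.

The operator is bidiagonal in the basis `(a z; p)_k (a z⁻¹; p)_k` (`awOp_awBasis_succ`). Hence the
image minus the `M`-th eigenvalue times the Q-polynomial has degree below `M`; having `M` distinct
zeros, it is zero. The resulting two-term recursion yields the Askey–Wilson coefficients up to a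
scalar (`eq_mul_awSeriesCoeff`), and monicity fixes the scalar (`awSeriesCoeff_mul_leadingCoeff`).
-/

theorem qPoch_zero (a p : ℂ) : qPoch a p 0 = 1 := by simp [qPoch]

theorem qPoch_succ (a p : ℂ) (n : ℕ) : qPoch a p (n + 1) = qPoch a p n * (1 - a * p ^ n) :=
  Finset.prod_range_succ _ _

theorem qPoch_succ' (a p : ℂ) (n : ℕ) : qPoch a p (n + 1) = (1 - a) * qPoch (a * p) p n := by
  rw [qPoch, Finset.prod_range_succ', mul_comm, qPoch]
  simp [pow_succ', mul_assoc]

theorem one_sub_ne_zero_of_qPoch_ne_zero {a p : ℂ} {n : ℕ} (h : qPoch a p n ≠ 0) {k : ℕ}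
    (hk : k < n) : 1 - a * p ^ k ≠ 0 :=
  Finset.prod_ne_zero_iff.1 h k (Finset.mem_range.2 hk)

theorem qPoch_ne_zero_of_le {a p : ℂ} {n k : ℕ} (h : qPoch a p n ≠ 0) (hk : k ≤ n) :
    qPoch a p k ≠ 0 :=
  Finset.prod_ne_zero_iff.2 fun _ hj =>
    one_sub_ne_zero_of_qPoch_ne_zero h ((Finset.mem_range.1 hj).trans_le hk)

theorem qPoch_add (a p : ℂ) (m n : ℕ) :
    qPoch a p (m + n) = qPoch a p m * qPoch (a * p ^ m) p n := by
  simp [qPoch, Finset.prod_range_add, pow_add, mul_assoc]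

/-- Splitting `(a; p)_{2n}` into its factors of even and of odd index. -/
theorem qPoch_two_mul (a p : ℂ) (n : ℕ) :
    qPoch a p (2 * n) = qPoch a (p ^ 2) n * qPoch (a * p) (p ^ 2) n := by
  induction n with
  | zero => simp [qPoch]
  | succ n ih =>
    rw [show 2 * (n + 1) = 2 * n + 1 + 1 by ring, qPoch_succ, qPoch_succ, ih, qPoch_succ,
      qPoch_succ]
    ring

/-- The reversal formula `(p^{-n}; p)_n p^n ∏_{j<n} (-p^j) = (p; p)_n`. -/
theorem qPoch_inv_pow_mul (p : ℂ) (hp : p ≠ 0) (n : ℕ) :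
    qPoch (p ^ n)⁻¹ p n * p ^ n * ∏ j ∈ Finset.range n, (-p ^ j) = qPoch p p n := by
  have hpow : p ^ n = ∏ _j ∈ Finset.range n, p := by simp
  rw [← Finset.prod_range_reflect (fun j => -p ^ j), qPoch, qPoch,
    ← Finset.prod_range_reflect (fun j => 1 - p * p ^ j)]
  nth_rw 2 [hpow]
  rw [← Finset.prod_mul_distrib, ← Finset.prod_mul_distrib]
  refine Finset.prod_congr rfl fun j hj => ?_
  obtain ⟨m, rfl⟩ := Nat.exists_eq_add_of_lt (Finset.mem_range.1 hj)
  rw [show j + m + 1 - 1 - j = m by omega]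
  field_simp
  ring

/-! ### The Askey–Wilson basis. -/

/-- The polynomial in `x = z + z⁻¹` whose value is `(a z; p)_k (a z⁻¹; p)_k`. -/
def awBasis (p a : ℂ) (k : ℕ) : ℂ[X] :=
  ∏ j ∈ Finset.range k, (C (-(a * p ^ j)) * X + C (1 + (a * p ^ j) ^ 2))

theorem eval_awBasis (p a : ℂ) (k : ℕ) {z : ℂ} (hz : z ≠ 0) :
    (awBasis p a k).eval (z + z⁻¹) = qPoch (a * z) p k * qPoch (a * z⁻¹) p k := by
  rw [awBasis, eval_prod, qPoch, qPoch, ← Finset.prod_mul_distrib]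
  refine Finset.prod_congr rfl fun j _ => ?_
  simp only [eval_add, eval_mul, eval_C, eval_X]
  field_simp
  ring

theorem degree_awBasis {p a : ℂ} (hp : p ≠ 0) (ha : a ≠ 0) (k : ℕ) :
    (awBasis p a k).degree = k := by
  rw [awBasis, degree_prod, Finset.sum_congr rfl fun j _ =>
    degree_linear (neg_ne_zero.2 (mul_ne_zero ha (pow_ne_zero j hp)))]
  simp

theorem leadingCoeff_awBasis {p a : ℂ} (hp : p ≠ 0) (ha : a ≠ 0) (k : ℕ) :
    (awBasis p a k).leadingCoeff = a ^ k * ∏ j ∈ Finset.range k, (-p ^ j) := by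
  rw [awBasis, leadingCoeff_prod, Finset.prod_congr rfl fun j _ =>
    leadingCoeff_linear (neg_ne_zero.2 (mul_ne_zero ha (pow_ne_zero j hp)))]
  simp_rw [← mul_neg, Finset.prod_mul_distrib, Finset.prod_const, Finset.card_range]

/-- The basis polynomials as a sequence of polynomials of increasing degree. -/
def awSequence (p a : ℂ) (hp : p ≠ 0) (ha : a ≠ 0) : Polynomial.Sequence ℂ :=
  ⟨awBasis p a, degree_awBasis hp ha⟩

theorem exists_eq_sum_awBasis {p a : ℂ} (hp : p ≠ 0) (ha : a ≠ 0) {n : ℕ} {f : ℂ[X]}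
    (hf : f.degree < n) :
    ∃ c : ℕ → ℂ, f = ∑ k ∈ Finset.range n, c k • awBasis p a k := by
  have h := (awSequence p a hp ha).span_degreeLT (m := n)
    (fun i _ => IsUnit.mk0 _ (leadingCoeff_ne_zero.2 ((awSequence p a hp ha).ne_zero i)))
  have hf' := mem_degreeLT.2 hf
  rw [← h, ← Finset.coe_range, Submodule.mem_span_image_finset_iff_exists_fun] at hf'
  obtain ⟨c, hc⟩ := hf'
  refine ⟨fun k => if hk : k ∈ Finset.range n then c ⟨k, hk⟩ else 0, hc.symm.trans ?_⟩
  rw [← Finset.sum_coe_sort (Finset.range n)]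
  exact Finset.sum_congr rfl fun k _ => by
    simp only [dif_pos k.2]
    rfl

/-! ### The Askey–Wilson operator and its bidiagonal action. -/

/-- The coefficient `A(z)` of the Askey-Wilson difference operator in base `p`. -/
def awCoeff (p a b c d z : ℂ) : ℂ :=
  (1 - a * z) * (1 - b * z) * (1 - c * z) * (1 - d * z) / ((1 - z ^ 2) * (1 - p * z ^ 2))

/-- The Askey-Wilson difference operator in base `p`, on polynomials in `x = z + z⁻¹`. -/
def awOp (p a b c d : ℂ) (f : ℂ[X]) (z : ℂ) : ℂ :=
  awCoeff p a b c d z * (f.eval (p * z + (p * z)⁻¹) - f.eval (z + z⁻¹))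
    + awCoeff p a b c d z⁻¹ * (f.eval (p * z⁻¹ + (p * z⁻¹)⁻¹) - f.eval (z + z⁻¹))

theorem awOp_sum_smul (p a b c d : ℂ) (s : Finset ℕ) (r : ℕ → ℂ) (f : ℕ → ℂ[X]) (z : ℂ) :
    awOp p a b c d (∑ k ∈ s, r k • f k) z = ∑ k ∈ s, r k * awOp p a b c d (f k) z := by
  simp only [awOp, eval_finsetSum, eval_smul, smul_eq_mul, ← Finset.sum_sub_distrib,
    Finset.mul_sum, ← Finset.sum_add_distrib]
  exact Finset.sum_congr rfl fun k _ => by ring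

/-- Points away from the poles of the coefficients of the Askey-Wilson operator. -/
structure IsRegularPoint (p z : ℂ) : Prop where
  ne_zero : z ≠ 0
  sq_ne_one : z ^ 2 ≠ 1
  mul_sq_ne_one : p * z ^ 2 ≠ 1
  sq_ne : z ^ 2 ≠ p

/-- The eigenvalues of the Askey-Wilson operator. -/
def awEigenvalue (p s : ℂ) (k : ℕ) : ℂ := (p ^ k)⁻¹ * (1 - p ^ k) * (1 - s * p ^ k * p⁻¹)

/-- The subdiagonal matrix entries of the Askey-Wilson operator in the basis `awBasis`. -/
def awLowering (p a b c d : ℂ) (k : ℕ) : ℂ :=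
  -((p ^ (k + 1))⁻¹ * (1 - p ^ (k + 1))
    * ((1 - a * b * p ^ k) * (1 - a * c * p ^ k) * (1 - a * d * p ^ k)))

/-- The shift `z ↦ p z` changes only end factors of the two products. The difference of these end
factors is a multiple of `1 - p z²`, which cancels that pole of the coefficient. -/
theorem awCoeff_mul_awBasis_sub {p z : ℂ} (hp : p ≠ 0) (hz : z ≠ 0) (hz₁ : z ^ 2 ≠ 1)
    (hz₂ : p * z ^ 2 ≠ 1) (a b c d : ℂ) (k : ℕ) :
    awCoeff p a b c d z * ((awBasis p a (k + 1)).eval (p * z + (p * z)⁻¹)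
        - (awBasis p a (k + 1)).eval (z + z⁻¹))
      = -(a * (1 - p ^ (k + 1))) / (p * z) * ((1 - b * z) * (1 - c * z) * (1 - d * z)
          * (1 - a * p ^ k * z) / (1 - z ^ 2)) * (awBasis p a k).eval (z + z⁻¹) := by
  rw [eval_awBasis p a _ (mul_ne_zero hp hz), eval_awBasis p a _ hz, eval_awBasis p a _ hz]
  have e₁ : qPoch (a * (p * z)⁻¹) p (k + 1) = (1 - a * (p * z)⁻¹) * qPoch (a * z⁻¹) p k := by
    rw [qPoch_succ']
    congr 2
    field_simp
  have e₂ : (1 - a * z) * qPoch (a * (p * z)) p k = qPoch (a * z) p k * (1 - a * z * p ^ k) := by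
    rw [← qPoch_succ, qPoch_succ']
    congr 2
    ring
  rw [e₁, qPoch_succ (a * (p * z)), qPoch_succ (a * z), ← e₂, qPoch_succ (a * z⁻¹), awCoeff]
  have e₃ : (1 - b * z) * (1 - c * z) * (1 - d * z) * (1 - a * p ^ k * z) / (1 - z ^ 2)
        * (qPoch (a * z) p k * qPoch (a * z⁻¹) p k)
      = (1 - b * z) * (1 - c * z) * (1 - d * z) / (1 - z ^ 2)
        * (((1 - a * z) * qPoch (a * (p * z)) p k) * qPoch (a * z⁻¹) p k) := by
    rw [e₂]
    ring
  rw [mul_assoc (-(a * (1 - p ^ (k + 1))) / (p * z)), e₃]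
  have h₁ : 1 - z ^ 2 ≠ 0 := sub_ne_zero.2 hz₁.symm
  have h₂ : 1 - z ^ 2 * p ≠ 0 := sub_ne_zero.2 (mul_comm p (z ^ 2) ▸ hz₂.symm)
  generalize qPoch (a * (p * z)) p k = A
  generalize qPoch (a * z⁻¹) p k = B
  rw [pow_succ p k]
  generalize p ^ k = P
  field_simp
  ring

theorem awOp_awBasis_zero (p a b c d z : ℂ) : awOp p a b c d (awBasis p a 0) z = 0 := by
  simp [awOp, awBasis]

/-- The two halves of the operator are exchanged by `z ↦ z⁻¹`; adding their contributions cancels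
the remaining pole at `z² = 1`. -/
theorem awOp_awBasis_succ {p z : ℂ} (hp : p ≠ 0) (hz : IsRegularPoint p z)
    (a b c d : ℂ) (k : ℕ) :
    awOp p a b c d (awBasis p a (k + 1)) z
      = awEigenvalue p (a * b * c * d) (k + 1) * (awBasis p a (k + 1)).eval (z + z⁻¹)
        + awLowering p a b c d k * (awBasis p a k).eval (z + z⁻¹) := by
  obtain ⟨h₀, h₁, h₂, h₃⟩ := hz
  have e := awCoeff_mul_awBasis_sub (z := z⁻¹) hp (inv_ne_zero h₀)
    (by simpa [inv_pow] using h₁)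
    (fun h => h₃ (by field_simp at h; exact h.symm)) a b c d k
  rw [inv_inv, add_comm z⁻¹ z] at e
  rw [awOp, awCoeff_mul_awBasis_sub hp h₀ h₁ h₂, e, eval_awBasis p a (k + 1) h₀, qPoch_succ,
    qPoch_succ, eval_awBasis p a k h₀, awEigenvalue, awLowering, pow_succ p k]
  have h₁' : 1 - z ^ 2 ≠ 0 := sub_ne_zero.2 h₁.symm
  have h₁'' : z ^ 2 - 1 ≠ 0 := sub_ne_zero.2 h₁
  have hP : p ^ k ≠ 0 := pow_ne_zero k hp
  generalize qPoch (a * z) p k = A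
  generalize qPoch (a * z⁻¹) p k = B
  generalize p ^ k = P at *
  rw [show (1 - z⁻¹ ^ 2) = -(1 - z ^ 2) / z ^ 2 by field_simp; ring]
  field_simp
  ring

/-- The Askey-Wilson operator maps polynomials in `z + z⁻¹` to polynomials in `z + z⁻¹`, and acts
on the expansion in `awBasis` by a bidiagonal matrix. -/
theorem awOp_sum_awBasis {p z : ℂ} (hp : p ≠ 0) (hz : IsRegularPoint p z)
    (a b c d : ℂ) (n : ℕ) (r : ℕ → ℂ) :
    awOp p a b c d (∑ k ∈ Finset.range (n + 1), r k • awBasis p a k) z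
      = awEigenvalue p (a * b * c * d) n
          * (∑ k ∈ Finset.range (n + 1), r k • awBasis p a k).eval (z + z⁻¹)
        + (∑ k ∈ Finset.range n,
            ((awEigenvalue p (a * b * c * d) k - awEigenvalue p (a * b * c * d) n) * r k
              + awLowering p a b c d k * r (k + 1)) • awBasis p a k).eval (z + z⁻¹) := by
  rw [awOp_sum_smul, Finset.sum_range_succ', awOp_awBasis_zero]
  simp only [awOp_awBasis_succ hp hz, eval_finsetSum, eval_smul, smul_eq_mul]
  have h0 : awEigenvalue p (a * b * c * d) 0 = 0 := by simp [awEigenvalue]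
  generalize awEigenvalue p (a * b * c * d) = lam at *
  generalize awLowering p a b c d = low
  -- The zeroth eigenvalue is zero, so the diagonal sum can be reindexed to start at `k = 0`.
  have key : ∑ k ∈ Finset.range n, r (k + 1) * (lam (k + 1) * (awBasis p a (k + 1)).eval (z + z⁻¹))
      = ∑ k ∈ Finset.range n, r k * (lam k * (awBasis p a k).eval (z + z⁻¹))
        + r n * (lam n * (awBasis p a n).eval (z + z⁻¹)) := by
    rw [← Finset.sum_range_succ (fun k => r k * (lam k * (awBasis p a k).eval (z + z⁻¹))),
      Finset.sum_range_succ', h0]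
    ring
  simp only [mul_add, Finset.sum_add_distrib, key, add_mul, sub_mul, Finset.sum_sub_distrib,
    Finset.sum_range_succ _ n, Finset.mul_sum, mul_zero]
  simp only [mul_assoc, mul_left_comm (low _), mul_left_comm (lam _) (r _)]
  ring

theorem exists_eval_eq_awOp {p a : ℂ} (hp : p ≠ 0) (ha : a ≠ 0) (b c d : ℂ) (f : ℂ[X]) :
    ∃ g : ℂ[X], ∀ z, IsRegularPoint p z → awOp p a b c d f z = g.eval (z + z⁻¹) := by
  obtain ⟨r, hr⟩ := exists_eq_sum_awBasis hp ha (f := f) (n := f.natDegree + 1)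
    (degree_le_natDegree.trans_lt (by exact_mod_cast Nat.lt_succ_self _))
  refine ⟨C (awEigenvalue p (a * b * c * d) f.natDegree) * f + ∑ k ∈ Finset.range f.natDegree,
    ((awEigenvalue p (a * b * c * d) k - awEigenvalue p (a * b * c * d) f.natDegree) * r k
      + awLowering p a b c d k * r (k + 1)) • awBasis p a k, fun z hz => ?_⟩
  rw [eval_add, eval_mul, eval_C]
  conv_lhs => rw [hr]
  rw [awOp_sum_awBasis hp hz, ← hr]

/-! ### From the Bethe equations to zeros of the image. -/

theorem bb_mul_bb_of_mul {q w u : ℂ} (hq : q ≠ 0) (hw : w ≠ 0) (hu : u ≠ 0) :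
    bb (q * w / u) * bb (q ^ 2 * w * u)
      = q ^ 2 * (q * w ^ 2) + (q ^ 2 * (q * w ^ 2))⁻¹ - (q * u ^ 2 + q⁻¹ * (u ^ 2)⁻¹) := by
  simp only [bb]
  field_simp
  ring

theorem bb_mul_bb_of_div {q w u : ℂ} (hq : q ≠ 0) (hw : w ≠ 0) (hu : u ≠ 0) :
    bb (w / (q * u)) * bb (w * u)
      = q ^ 2 * (q * w ^ 2)⁻¹ + (q ^ 2 * (q * w ^ 2)⁻¹)⁻¹ - (q * u ^ 2 + q⁻¹ * (u ^ 2)⁻¹) := by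
  simp only [bb]
  field_simp
  ring

/-- The vacuum eigenvalue in terms of `z = q w²` and the Askey-Wilson parameters. -/
theorem vacF_eq {q v w : ℂ} (hq : q ≠ 0) (hv : v ≠ 0) (hw : w ≠ 0) (N : ℕ) (μ μ' : ℂ) :
    vacF q N μ μ' v w = q ^ N * q⁻¹ * ((q * w ^ 2) ^ 2)⁻¹
      * ((q * w ^ 2 - -q * Complex.exp (-μ + μ')) * (q * w ^ 2 - -q * Complex.exp (μ + μ'))
        * (q * w ^ 2 - (q ^ N)⁻¹ * v ^ 2) * (q * w ^ 2 - (q ^ N)⁻¹ * (v ^ 2)⁻¹)) := by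
  have hN : q ^ N ≠ 0 := pow_ne_zero N hq
  rw [vacF, show -μ + μ' = μ' - μ by ring, pow_succ q N]
  generalize q ^ N = Q at *
  generalize Complex.exp (μ' - μ) = s
  generalize Complex.exp (μ + μ') = t
  field_simp
  ring

/-- The monic polynomial with roots `q u_j² + q⁻¹ u_j⁻²`, `j ∈ s`. -/
def betheProd (q : ℂ) {M : ℕ} (u : Fin M → ℂ) (s : Finset (Fin M)) : ℂ[X] :=
  ∏ j ∈ s, (X - C (q * u j ^ 2 + q⁻¹ * (u j ^ 2)⁻¹))

theorem eval_betheProd (q : ℂ) {M : ℕ} (u : Fin M → ℂ) (s : Finset (Fin M)) (x : ℂ) :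
    (betheProd q u s).eval x = ∏ j ∈ s, (x - (q * u j ^ 2 + q⁻¹ * (u j ^ 2)⁻¹)) := by
  simp [betheProd, eval_prod]

/-- Pulling a linear factor out of the Askey-Wilson operator leaves the Bethe function. -/
theorem awOp_X_sub_C_mul {p z : ℂ} (hp : p ≠ 0) (hz : IsRegularPoint p z) (a b c d y : ℂ)
    (f : ℂ[X]) :
    awOp p a b c d ((X - C y) * f) z
      = (p - 1) * p⁻¹
          * ((f.eval (p * z + (p * z)⁻¹)
                * ((z ^ 2)⁻¹ * ((1 - a * z) * (1 - b * z) * (1 - c * z) * (1 - d * z)))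
              - f.eval (p * z⁻¹ + (p * z⁻¹)⁻¹)
                * ((z ^ 2)⁻¹ * ((z - a) * (z - b) * (z - c) * (z - d)))) / (z - z⁻¹))
        + (z + z⁻¹ - y) * awOp p a b c d f z := by
  obtain ⟨h₀, h₁, h₂, h₃⟩ := hz
  have h₁' : 1 - z ^ 2 ≠ 0 := sub_ne_zero.2 h₁.symm
  have h₁'' : z ^ 2 - 1 ≠ 0 := sub_ne_zero.2 h₁
  have h₂' : 1 - z ^ 2 * p ≠ 0 := sub_ne_zero.2 (mul_comm p (z ^ 2) ▸ h₂.symm)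
  have h₃' : z ^ 2 - p ≠ 0 := sub_ne_zero.2 h₃
  simp only [awOp, awCoeff, eval_mul, eval_sub, eval_X, eval_C]
  generalize f.eval (p * z + (p * z)⁻¹) = A
  generalize f.eval (p * z⁻¹ + (p * z⁻¹)⁻¹) = B
  generalize f.eval (z + z⁻¹) = D
  rw [show 1 - z⁻¹ ^ 2 = -(1 - z ^ 2) / z ^ 2 by field_simp; ring,
    show 1 - p * z⁻¹ ^ 2 = (z ^ 2 - p) / z ^ 2 by field_simp,
    show z - z⁻¹ = -(1 - z ^ 2) / z by field_simp; ring]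
  field_simp
  ring

/-- In the variable `z = q w²`, the products in the Bethe function are values of the reduced
Q-polynomial at the shifted points `p z` and `p z⁻¹`, and `w ↦ q⁻¹ w⁻¹` in the vacuum function is `z
↦ z⁻¹`. -/
theorem awOp_betheProd_univ {q v w : ℂ} (hq : q ≠ 0) (hv : v ≠ 0) (hw : w ≠ 0)
    (hz : IsRegularPoint (q ^ 2) (q * w ^ 2)) (N : ℕ) (μ μ' : ℂ) {M : ℕ} {u : Fin M → ℂ}
    (hu : ∀ i, u i ≠ 0) (i : Fin M) {a b c d : ℂ}
    (ha : a = -q * Complex.exp (-μ + μ')) (hb : b = -q * Complex.exp (μ + μ'))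
    (hc : c = (q ^ N)⁻¹ * v ^ 2) (hd : d = (q ^ N)⁻¹ * (v ^ 2)⁻¹) :
    awOp (q ^ 2) a b c d (betheProd q u Finset.univ) (q * w ^ 2)
      = (q ^ 2 - 1) * (q ^ 2)⁻¹ * (q ^ N * q⁻¹)⁻¹ * betheFun q N μ μ' v u i w
        + (q * w ^ 2 + (q * w ^ 2)⁻¹ - (q * u i ^ 2 + q⁻¹ * (u i ^ 2)⁻¹))
          * awOp (q ^ 2) a b c d (betheProd q u (Finset.univ.erase i)) (q * w ^ 2) := by
  have hz₀ := hz.ne_zero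
  have e₁ := vacF_eq hq hv hw N μ μ'
  have e₂ := vacF_eq hq hv (w := q⁻¹ * w⁻¹) (mul_ne_zero (inv_ne_zero hq) (inv_ne_zero hw)) N μ μ'
  rw [← ha, ← hb, ← hc, ← hd] at e₁ e₂
  rw [show q * (q⁻¹ * w⁻¹) ^ 2 = (q * w ^ 2)⁻¹ by field_simp] at e₂
  rw [betheProd, ← Finset.mul_prod_erase _ _ (Finset.mem_univ i), ← betheProd,
    awOp_X_sub_C_mul (pow_ne_zero 2 hq) hz, betheFun, e₁, e₂, eval_betheProd, eval_betheProd]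
  simp only [fun j => bb_mul_bb_of_mul hq hw (hu j), fun j => bb_mul_bb_of_div hq hw (hu j)]
  rw [bb]
  congr 1
  have hN : q ^ N ≠ 0 := pow_ne_zero N hq
  generalize q * w ^ 2 = z at *
  generalize ∏ j ∈ Finset.univ.erase i,
    (q ^ 2 * z + (q ^ 2 * z)⁻¹ - (q * u j ^ 2 + q⁻¹ * (u j ^ 2)⁻¹)) = A
  generalize ∏ j ∈ Finset.univ.erase i,
    (q ^ 2 * z⁻¹ + (q ^ 2 * z⁻¹)⁻¹ - (q * u j ^ 2 + q⁻¹ * (u j ^ 2)⁻¹)) = B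
  generalize q ^ N = Q at *
  have h₁ : z - z⁻¹ ≠ 0 := fun h => hz.sq_ne_one (by field_simp at h; linear_combination h)
  rw [mul_assoc _ (Q * q⁻¹)⁻¹]
  congr 1
  rw [← mul_div_assoc]
  congr 1
  field_simp

theorem eventually_isRegularPoint {q : ℂ} (hq : q ≠ 0) {y : ℂ} :
    ∀ᶠ w in 𝓝[≠] y, w ≠ 0 ∧ IsRegularPoint (q ^ 2) (q * w ^ 2) := by
  -- Each excluded condition on `z = q w²` fixes the value of `w⁴`, so only finitely many `w` are
  -- lost.
  have key (t : ℂ) : ∀ᶠ w in 𝓝[≠] y, w ^ 4 ≠ t := by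
    refine nhdsNE_le_cofinite y (Set.Finite.subset (nthRoots 4 t).toFinset.finite_toSet ?_)
    intro w hw
    have hw : w ^ 4 = t := by simpa using hw
    simpa [mem_nthRoots] using hw
  filter_upwards [key 0, key (q ^ 2)⁻¹, key (q ^ 4)⁻¹, key 1] with w h₀ h₁ h₂ h₃
  have hw : w ≠ 0 := fun h => h₀ (by simp [h])
  refine ⟨hw, mul_ne_zero hq (pow_ne_zero 2 hw), fun h => h₁ ?_, fun h => h₂ ?_, fun h => h₃ ?_⟩
  · exact eq_inv_of_mul_eq_one_left (by linear_combination h)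
  · exact eq_inv_of_mul_eq_one_left (by linear_combination h)
  · exact mul_left_cancel₀ (pow_ne_zero 2 hq) (by linear_combination h)

/-- If the Bethe equations hold, the image of the Q-polynomial under the Askey-Wilson operator
vanishes at the roots of the Q-polynomial. -/
theorem eval_awOp_betheProd_eq_zero {q v : ℂ} (hq : q ≠ 0) (hv : v ≠ 0) {N : ℕ} {μ μ' : ℂ}
    {M : ℕ} {u : Fin M → ℂ} (hu : IsBetheRoots q N μ μ' v u) (i : Fin M) {a b c d : ℂ}
    (ha : a = -q * Complex.exp (-μ + μ')) (hb : b = -q * Complex.exp (μ + μ'))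
    (hc : c = (q ^ N)⁻¹ * v ^ 2) (hd : d = (q ^ N)⁻¹ * (v ^ 2)⁻¹) {g : ℂ[X]}
    (hg : ∀ z, IsRegularPoint (q ^ 2) z →
      awOp (q ^ 2) a b c d (betheProd q u Finset.univ) z = g.eval (z + z⁻¹)) :
    g.eval (q * u i ^ 2 + q⁻¹ * (u i ^ 2)⁻¹) = 0 := by
  have ha₀ : a ≠ 0 := ha ▸ mul_ne_zero (neg_ne_zero.2 hq) (Complex.exp_ne_zero _)
  obtain ⟨f, hf⟩ := exists_eval_eq_awOp (pow_ne_zero 2 hq) ha₀ b c d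
    (betheProd q u (Finset.univ.erase i))
  have hui := hu.ne_zero i
  -- `q u_i²` may be a pole of the operator coefficients, so the identity is passed to the limit `w
  -- → u_i`. Since `f` is a polynomial, its term dies with the linear factor.
  have hx : Tendsto (fun w => q * w ^ 2 + (q * w ^ 2)⁻¹) (𝓝[≠] (u i))
      (𝓝 (q * u i ^ 2 + q⁻¹ * (u i ^ 2)⁻¹)) := by
    rw [← mul_inv]
    refine tendsto_nhdsWithin_of_tendsto_nhds (ContinuousAt.tendsto ?_)
    have : q * u i ^ 2 ≠ 0 := mul_ne_zero hq (pow_ne_zero 2 hui)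
    fun_prop (disch := assumption)
  have hleft := (g.continuous.tendsto _).comp hx
  have hright := ((hu.bethe i).const_mul ((q ^ 2 - 1) * (q ^ 2)⁻¹ * (q ^ N * q⁻¹)⁻¹)).add
    ((hx.sub_const (q * u i ^ 2 + q⁻¹ * (u i ^ 2)⁻¹)).mul ((f.continuous.tendsto _).comp hx))
  rw [mul_zero, sub_self, zero_mul, add_zero] at hright
  refine tendsto_nhds_unique (hleft.congr' ?_) hright
  filter_upwards [eventually_isRegularPoint hq] with w hw
  rw [Function.comp_apply, Function.comp_apply, ← hg _ hw.2, ← hf _ hw.2]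
  exact awOp_betheProd_univ hq hv hw.1 hw.2 N μ μ' hu.ne_zero i ha hb hc hd

/-! ### Series coefficients and normalization. -/

/-- The coefficients of the Askey-Wilson polynomial in base `p` in the basis `awBasis`. -/
def awSeriesCoeff (p a b c d : ℂ) (M k : ℕ) : ℂ :=
  qPoch (p ^ M)⁻¹ p k * qPoch (a * b * c * d * p ^ M * p⁻¹) p k
    / (qPoch (a * b) p k * qPoch (a * c) p k * qPoch (a * d) p k * qPoch p p k) * p ^ k

theorem askeyWilson_eq {q z : ℂ} (hq : q ≠ 0) (hz : z ≠ 0) (a b c d : ℂ) (M : ℕ) :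
    askeyWilson q a b c d M z
      = (∑ k ∈ Finset.range (M + 1),
          awSeriesCoeff (q ^ 2) a b c d M k • awBasis (q ^ 2) a k).eval (z + z⁻¹) := by
  have e₁ : q ^ (-(2 * M : ℤ)) = ((q ^ 2) ^ M)⁻¹ := by
    rw [zpow_neg, ← pow_mul]
    norm_cast
  have e₂ : a * b * c * d * q ^ (2 * M - 2 : ℤ) = a * b * c * d * (q ^ 2) ^ M * (q ^ 2)⁻¹ := by
    rw [zpow_sub₀ hq, ← pow_mul, div_eq_mul_inv, mul_assoc]
    norm_cast
    ring
  simp only [askeyWilson, awSeriesCoeff, e₁, e₂, eval_finsetSum, eval_smul, smul_eq_mul,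
    eval_awBasis _ _ _ hz]
  exact Finset.sum_congr rfl fun k _ => by ring

theorem qPoch_self_ne_zero {p : ℂ} (hp : ∀ n : ℕ, 0 < n → p ^ n ≠ 1) (n : ℕ) :
    qPoch p p n ≠ 0 :=
  Finset.prod_ne_zero_iff.2 fun k _ => sub_ne_zero.2 fun h =>
    hp (k + 1) k.succ_pos (by rw [pow_succ', h])

/-- The coefficients of an eigenpolynomial are those of the Askey-Wilson polynomial. -/
theorem eq_mul_awSeriesCoeff {p a b c d : ℂ} (hp₀ : p ≠ 0) (hp : ∀ n : ℕ, 0 < n → p ^ n ≠ 1)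
    {M : ℕ} (hab : qPoch (a * b) p M ≠ 0) (hac : qPoch (a * c) p M ≠ 0)
    (had : qPoch (a * d) p M ≠ 0) {r : ℕ → ℂ}
    (hr : ∀ k < M, (awEigenvalue p (a * b * c * d) k - awEigenvalue p (a * b * c * d) M) * r k
      + awLowering p a b c d k * r (k + 1) = 0) {k : ℕ} (hk : k ≤ M) :
    r k = r 0 * awSeriesCoeff p a b c d M k := by
  induction k with
  | zero => simp [awSeriesCoeff, qPoch_zero]
  | succ k ih =>
    have hkM : k < M := hk
    have h := hr k hkM
    rw [ih hkM.le] at h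
    have f₁ := qPoch_ne_zero_of_le hab hkM.le
    have f₂ := qPoch_ne_zero_of_le hac hkM.le
    have f₃ := qPoch_ne_zero_of_le had hkM.le
    have f₄ := qPoch_self_ne_zero hp k
    have g₁ := one_sub_ne_zero_of_qPoch_ne_zero hab hkM
    have g₂ := one_sub_ne_zero_of_qPoch_ne_zero hac hkM
    have g₃ := one_sub_ne_zero_of_qPoch_ne_zero had hkM
    have g₄ : 1 - p * p ^ k ≠ 0 := one_sub_ne_zero_of_qPoch_ne_zero
      (qPoch_self_ne_zero hp (k + 1)) k.lt_succ_self
    have hM₀ : p ^ M ≠ 0 := pow_ne_zero M hp₀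
    have hk₀ : p ^ k ≠ 0 := pow_ne_zero k hp₀
    -- The recursion is solved upward from `r 0`, so only the subdiagonal entries must be
    -- invertible; eigenvalues may coincide.
    have hlow : awLowering p a b c d k ≠ 0 := by
      rw [awLowering, pow_succ']
      exact neg_ne_zero.2 (mul_ne_zero (mul_ne_zero (inv_ne_zero (mul_ne_zero hp₀ hk₀)) g₄)
        (mul_ne_zero (mul_ne_zero g₁ g₂) g₃))
    have hstep : awLowering p a b c d k * awSeriesCoeff p a b c d M (k + 1)
        = (awEigenvalue p (a * b * c * d) M - awEigenvalue p (a * b * c * d) k)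
          * awSeriesCoeff p a b c d M k := by
      simp only [awLowering, awSeriesCoeff, awEigenvalue, qPoch_succ, pow_succ' p k]
      generalize 1 - a * b * p ^ k = G₁ at *
      generalize 1 - a * c * p ^ k = G₂ at *
      generalize 1 - a * d * p ^ k = G₃ at *
      generalize qPoch (a * b) p k = F₁ at *
      generalize qPoch (a * c) p k = F₂ at *
      generalize qPoch (a * d) p k = F₃ at *
      generalize qPoch p p k = F₄ at *
      generalize p ^ k = K at *
      generalize p ^ M = L at *
      field_simp
      ring
    refine mul_left_cancel₀ hlow ?_
    linear_combination h - r 0 * hstep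

/-- The normalization of the monic Askey-Wilson polynomial. -/
theorem awSeriesCoeff_mul_leadingCoeff {p a b c d : ℂ} (hp₀ : p ≠ 0)
    (hp : ∀ n : ℕ, 0 < n → p ^ n ≠ 1) (ha : a ≠ 0) {M : ℕ} (hab : qPoch (a * b) p M ≠ 0)
    (hac : qPoch (a * c) p M ≠ 0) (had : qPoch (a * d) p M ≠ 0)
    (h₁ : qPoch (a * b * c * d * p⁻¹) (p ^ 2) M ≠ 0) (h₂ : qPoch (a * b * c * d) (p ^ 2) M ≠ 0) :
    qPoch (a * b) p M * qPoch (a * c) p M * qPoch (a * d) p M * qPoch (a * b * c * d * p⁻¹) p M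
        / (a ^ M * qPoch (a * b * c * d * p⁻¹) (p ^ 2) M * qPoch (a * b * c * d) (p ^ 2) M)
      * (awSeriesCoeff p a b c d M M * (awBasis p a M).leadingCoeff) = 1 := by
  -- Both sides are `(abcd p⁻¹; p)_{2M}`, split into consecutive halves on the left and by parity of
  -- the index on the right.
  have e : qPoch (a * b * c * d * p⁻¹) p M * qPoch (a * b * c * d * p ^ M * p⁻¹) p M
      = qPoch (a * b * c * d * p⁻¹) (p ^ 2) M * qPoch (a * b * c * d) (p ^ 2) M := by
    have h := qPoch_two_mul (a * b * c * d * p⁻¹) p M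
    rw [two_mul, qPoch_add, inv_mul_cancel_right₀ hp₀] at h
    rw [← h, mul_right_comm _ (p ^ M)]
  have f₄ := qPoch_self_ne_zero hp M
  have haM := pow_ne_zero M ha
  rw [leadingCoeff_awBasis hp₀ ha, awSeriesCoeff]
  calc _ = (qPoch (a * b * c * d * p⁻¹) p M * qPoch (a * b * c * d * p ^ M * p⁻¹) p M)
          / (qPoch (a * b * c * d * p⁻¹) (p ^ 2) M * qPoch (a * b * c * d) (p ^ 2) M)
        * ((qPoch (p ^ M)⁻¹ p M * p ^ M * ∏ j ∈ Finset.range M, (-p ^ j)) / qPoch p p M) := by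
        field_simp
    _ = 1 := by
      rw [e, qPoch_inv_pow_mul p hp₀, div_self (mul_ne_zero h₁ h₂), div_self f₄, one_mul]

theorem monic_betheProd (q : ℂ) {M : ℕ} (u : Fin M → ℂ) (s : Finset (Fin M)) :
    (betheProd q u s).Monic :=
  monic_prod_of_monic _ _ fun _ _ => monic_X_sub_C _

theorem natDegree_betheProd_univ (q : ℂ) {M : ℕ} (u : Fin M → ℂ) :
    (betheProd q u Finset.univ).natDegree = M := by
  rw [betheProd, natDegree_prod_of_monic _ _ fun _ _ => monic_X_sub_C _]
  simp only [natDegree_X_sub_C, Finset.sum_const, Finset.card_univ, Fintype.card_fin, smul_eq_mul,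
    mul_one]

theorem eval_QPoly (q : ℂ) {M : ℕ} (u : Fin M → ℂ) (x : ℂ) :
    (QPoly q u).eval (x / (q + q⁻¹))
      = (betheProd q u Finset.univ).eval x / (q + q⁻¹) ^ M := by
  rw [QPoly, eval_prod, eval_betheProd]
  simp only [eval_sub, eval_X, eval_C, symVar, ← sub_div, Finset.prod_div_distrib,
    Finset.prod_const, Finset.card_univ, Fintype.card_fin]

theorem eq_zero_of_sum_awBasis_eq_zero {p a : ℂ} (hp : p ≠ 0) (ha : a ≠ 0) {n : ℕ} {r : ℕ → ℂ}
    (h : ∑ k ∈ Finset.range n, r k • awBasis p a k = 0) {k : ℕ} (hk : k < n) : r k = 0 :=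
  linearIndependent_iff'.1 (awSequence p a hp ha).linearIndependent (Finset.range n) r h k
    (Finset.mem_range.2 hk)

theorem degree_sum_awBasis_lt {p a : ℂ} (hp : p ≠ 0) (ha : a ≠ 0) (n : ℕ) (r : ℕ → ℂ) :
    (∑ k ∈ Finset.range n, r k • awBasis p a k).degree < n := by
  refine mem_degreeLT.1 (Submodule.sum_mem _ fun k hk => Submodule.smul_mem _ _ ?_)
  rw [mem_degreeLT, degree_awBasis hp ha]
  exact_mod_cast Finset.mem_range.1 hk

theorem coeff_sum_awBasis {p a : ℂ} (hp : p ≠ 0) (ha : a ≠ 0) (n : ℕ) (r : ℕ → ℂ) :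
    (∑ k ∈ Finset.range (n + 1), r k • awBasis p a k).coeff n
      = r n * (awBasis p a n).leadingCoeff := by
  rw [Finset.sum_range_succ, coeff_add, coeff_eq_zero_of_degree_lt (degree_sum_awBasis_lt hp ha n r),
    zero_add, coeff_smul, smul_eq_mul, leadingCoeff,
    natDegree_eq_of_degree_eq_some (degree_awBasis hp ha n)]

end HeunAW

end

/-! ### The main theorem. -/

open HeunAW in
theorem proposition4p6
    (q : ℂ) (hq0 : q ≠ 0) (hq : ∀ n : ℕ, 0 < n → q ^ n ≠ 1)
    (N : ℕ) (μ μ' v : ℂ) (hv : v ≠ 0)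
    (M : ℕ) (hM : M ≤ N)
    (a b c d : ℂ)
    (ha : a = -q * Complex.exp (-μ + μ')) (hb : b = -q * Complex.exp (μ + μ'))
    (hc : c = (q ^ N)⁻¹ * v ^ 2) (hd : d = (q ^ N)⁻¹ * (v ^ 2)⁻¹)
    (hab : HeunAW.qPoch (a * b) (q ^ 2) M ≠ 0)
    (hac : HeunAW.qPoch (a * c) (q ^ 2) M ≠ 0)
    (had : HeunAW.qPoch (a * d) (q ^ 2) M ≠ 0)
    (h₁ : HeunAW.qPoch (a * b * c * d * (q ^ 2)⁻¹) (q ^ 4) M ≠ 0)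
    (h₂ : HeunAW.qPoch (a * b * c * d) (q ^ 4) M ≠ 0)
    (u : Fin M → ℂ) (hu : HeunAW.IsBetheRoots q N μ μ' v u)
    (z : ℂ) (hz : z ≠ 0) :
    (HeunAW.QPoly q u).eval ((z + z⁻¹) / (q + q⁻¹)) =
      HeunAW.qPoch (a * b) (q ^ 2) M * HeunAW.qPoch (a * c) (q ^ 2) M
          * HeunAW.qPoch (a * d) (q ^ 2) M * HeunAW.qPoch (a * b * c * d * (q ^ 2)⁻¹) (q ^ 2) M
        / ((q + q⁻¹) ^ M * a ^ M * HeunAW.qPoch (a * b * c * d * (q ^ 2)⁻¹) (q ^ 4) M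
            * HeunAW.qPoch (a * b * c * d) (q ^ 4) M)
        * HeunAW.askeyWilson q a b c d M z := by
  have hp₀ : q ^ 2 ≠ 0 := pow_ne_zero 2 hq0
  have hp (n : ℕ) (hn : 0 < n) : (q ^ 2) ^ n ≠ 1 := by
    rw [← pow_mul]
    exact hq _ (by positivity)
  have ha₀ : a ≠ 0 := ha ▸ mul_ne_zero (neg_ne_zero.2 hq0) (Complex.exp_ne_zero _)
  rw [show q ^ 4 = (q ^ 2) ^ 2 by ring] at h₁ h₂ ⊢
  have hdeg : (betheProd q u Finset.univ).degree < (M + 1 : ℕ) := by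
    rw [degree_eq_natDegree (monic_betheProd q u _).ne_zero, natDegree_betheProd_univ]
    exact_mod_cast M.lt_succ_self
  obtain ⟨r, hr⟩ := exists_eq_sum_awBasis hp₀ ha₀ hdeg
  have hrem : ∑ k ∈ Finset.range M,
      ((awEigenvalue (q ^ 2) (a * b * c * d) k - awEigenvalue (q ^ 2) (a * b * c * d) M) * r k
        + awLowering (q ^ 2) a b c d k * r (k + 1)) • awBasis (q ^ 2) a k = 0 := by
    refine eq_zero_of_degree_lt_of_eval_index_eq_zero Finset.univ
      (v := fun i => q * u i ^ 2 + q⁻¹ * (u i ^ 2)⁻¹) ?_ ?_ fun i _ => ?_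
    · intro i _ j _ hij
      exact hu.admissible (congrArg (· / (q + q⁻¹)) hij)
    · simpa using degree_sum_awBasis_lt hp₀ ha₀ M _
    -- The polynomial `g` is the image of the Q-polynomial; at a root its eigenvalue term vanishes,
    -- so the remainder does too.
    · have h := eval_awOp_betheProd_eq_zero hq0 hv hu i ha hb hc hd
        (g := C (awEigenvalue (q ^ 2) (a * b * c * d) M) * betheProd q u Finset.univ
          + ∑ k ∈ Finset.range M, ((awEigenvalue (q ^ 2) (a * b * c * d) k
            - awEigenvalue (q ^ 2) (a * b * c * d) M) * r k
            + awLowering (q ^ 2) a b c d k * r (k + 1)) • awBasis (q ^ 2) a k)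
        (fun w hw => by rw [eval_add, eval_mul, eval_C, hr, awOp_sum_awBasis hp₀ hw])
      rwa [eval_add, eval_mul, eval_betheProd,
        Finset.prod_eq_zero (Finset.mem_univ i) (sub_self _), mul_zero, zero_add] at h
  have hcoeff (k : ℕ) (hk : k ≤ M) := eq_mul_awSeriesCoeff hp₀ hp hab hac had
    (fun _ => eq_zero_of_sum_awBasis_eq_zero hp₀ ha₀ hrem) hk
  have hlead : r 0 * (awSeriesCoeff (q ^ 2) a b c d M M * (awBasis (q ^ 2) a M).leadingCoeff)
      = 1 := by
    rw [← mul_assoc, ← hcoeff M le_rfl, ← coeff_sum_awBasis hp₀ ha₀, ← hr]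
    have h := (monic_betheProd q u Finset.univ).coeff_natDegree
    rwa [natDegree_betheProd_univ] at h
  have hnorm := awSeriesCoeff_mul_leadingCoeff hp₀ hp ha₀ hab hac had h₁ h₂
  -- `r 0` and the claimed constant are inverses of the same number.
  have hr₀ := mul_right_cancel₀ (right_ne_zero_of_mul_eq_one hlead) (hlead.trans hnorm.symm)
  have hP : betheProd q u Finset.univ = r 0 • ∑ k ∈ Finset.range (M + 1),
      awSeriesCoeff (q ^ 2) a b c d M k • awBasis (q ^ 2) a k := by
    rw [hr, Finset.smul_sum]
    refine Finset.sum_congr rfl fun k hk => ?_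
    rw [hcoeff k (Nat.lt_succ_iff.1 (Finset.mem_range.1 hk)), mul_smul]
  rw [eval_QPoly, askeyWilson_eq hq0 hz, hP, eval_smul, smul_eq_mul, hr₀]
  simp only [div_eq_mul_inv, mul_inv]
  ring
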